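/- Let $|i\pm j\rangle=\frac1{\sqrt2}(|i\rangle\pm|j\rangle)$. In $\mathbb C^3\otimes\mathbb C^2\otimes\mathbb C^2$ (systems $A,B,C$) consider the ten product states $$\psi_{1,2}=|0\mp1\rangle|0\rangle|0\rangle,\quad \psi_{3,4}=|2\mp0\rangle|1\rangle|0\rangle,\quad \psi_{5,6}=|1\rangle|1\rangle|0\mp1\rangle,\quad \psi_{7,8}=|1\mp2\rangle|0\rangle|1\rangle,\quad \psi_{9,10}=|0\rangle|0\mp1\rangle|1\rangle$$ (upper sign for the first index). They are orthonormal, and they are locally indistinguishable in exactly one bipartition, as follows. For two parties, an LOCC protocol consists of rounds in each of which one party performs a generalized measurement with finitely many outcomes on its own system (given by Kraus operators $K_k$ with $\sum_kK_k^\dagger K_k=1$, possibly changing the dimension), communicates the outcome, and the continuation may depend on all outcomes so far; when it stops, the parties announce a guess. It may have finitely many rounds, or infinitely many; in the latter case it is given by a sequence of finite protocols each extending the previous one. A family of states is perfectly distinguishable by LOCC if for some protocol the probability of a correct guess is $1$ for every state of the family (for an infinite protocol: tends to $1$ along the sequence). 1. In the bipartitions $B|CA$ and $C|AB$ (the two parties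 written together act as one) the ten states are perfectly distinguishable by LOCC, with finitely many rounds. 2. Relabel the basis of $BC$, $\mathbb C^2\otimes\mathbb C^2\cong\mathbb C^4$, by $|10\rangle\to|0\rangle$, $|11\rangle\to|1\rangle$, $|01\rangle\to|2\rangle$, $|00\rangle\to|3\rangle$. Then, after a suitable permutation of the basis of $A$ and up to global phases, $\psi_3,\dots,\psi_{10}$ are exactly the eight domino states $|0\rangle|0\pm1\rangle$, $|0\pm1\rangle|2\rangle$, $|2\rangle|1\pm2\rangle$, $|1\pm2\rangle|0\rangle$ of $\mathbb C^3\otimes\mathbb C^3\subset\mathbb C^3\otimes\mathbb C^4$ (of Bennett et al.). 3. In the bipartition $A|BC$ the eight states $\psi_3,\dots,\psi_{10}$, and hence also all ten states, are not perfectly distinguishable by LOCC, not even with infinitely many rounds. -/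

import Mathlib

namespace ProductStates

/-! ### Bipartite LOCC protocols

A vector of `ℂ^a ⊗ ℂ^b` is given by its coordinates, a function `Fin a × Fin b → ℂ`. -/

/-- `(K ⊗ 1) v` : the first party applies `K : ℂ^a → ℂ^a'`. -/
noncomputable def applyFst {a a' b : ℕ} (K : Matrix (Fin a') (Fin a) ℂ)
    (v : Fin a × Fin b → ℂ) : Fin a' × Fin b → ℂ :=
  fun x => ∑ s, K x.1 s * v (s, x.2)

/-- `(1 ⊗ K) v` : the second party applies `K : ℂ^b → ℂ^b'`. -/
noncomputable def applySnd {a b b' : ℕ} (K : Matrix (Fin b') (Fin b) ℂ)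
    (v : Fin a × Fin b → ℂ) : Fin a × Fin b' → ℂ :=
  fun x => ∑ s, K x.2 s * v (x.1, s)

/-- LOCC protocols with finitely many rounds for two parties whose current systems are `ℂ^a` and
`ℂ^b`, and which end with the announcement of a guess in `ι`.  In a round one of the parties
performs a generalized measurement on its own system, that is, finitely many Kraus operators `K k`
with `∑ k, (K k)ᴴ * K k = 1`; the outcome `k` is communicated, and everything that follows may
depend on it.  The dimension of the system after a measurement is arbitrary and may depend on the
outcome, so that local ancillas, local unitaries, discarding and (by measurements with Kraus
operators proportional to the identity) randomness are included. -/
inductive Protocol (ι : Type) : ℕ → ℕ → Type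
  | guess {a b : ℕ} (i : ι) : Protocol ι a b
  | fst {a b : ℕ} (m : ℕ) (d : Fin m → ℕ) (K : ∀ k, Matrix (Fin (d k)) (Fin a) ℂ)
      (hK : ∑ k, (K k).conjTranspose * K k = 1) (next : ∀ k, Protocol ι (d k) b) :
      Protocol ι a b
  | snd {a b : ℕ} (m : ℕ) (d : Fin m → ℕ) (K : ∀ k, Matrix (Fin (d k)) (Fin b) ℂ)
      (hK : ∑ k, (K k).conjTranspose * K k = 1) (next : ∀ k, Protocol ι a (d k)) :
      Protocol ι a b

/-- The probability that the protocol, run on the state `v`, ends with the guess `i`.  (States are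
carried along unnormalized, so the probability of a branch is the squared norm of its final
vector.) -/
noncomputable def Protocol.prob {ι : Type} [DecidableEq ι] :
    {a b : ℕ} → Protocol ι a b → (Fin a × Fin b → ℂ) → ι → ℝ
  | _, _, .guess j, v, i => if j = i then ∑ x, ‖v x‖ ^ 2 else 0
  | _, _, .fst _ _ K _ next, v, i => ∑ k, (next k).prob (applyFst (K k) v) i
  | _, _, .snd _ _ K _ next, v, i => ∑ k, (next k).prob (applySnd (K k) v) i

/-- `P.Extends Q` : the protocol `Q` runs exactly as `P`, except that instead of announcing the
guess of `P` the parties may go on with further rounds. -/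
inductive Protocol.Extends {ι : Type} : {a b : ℕ} → Protocol ι a b → Protocol ι a b → Prop
  | guess {a b : ℕ} (i : ι) (Q : Protocol ι a b) : Extends (.guess i) Q
  | fst {a b : ℕ} (m : ℕ) (d : Fin m → ℕ) (K : ∀ k, Matrix (Fin (d k)) (Fin a) ℂ)
      (hK : ∑ k, (K k).conjTranspose * K k = 1) (P Q : ∀ k, Protocol ι (d k) b)
      (h : ∀ k, Extends (P k) (Q k)) : Extends (.fst m d K hK P) (.fst m d K hK Q)
  | snd {a b : ℕ} (m : ℕ) (d : Fin m → ℕ) (K : ∀ k, Matrix (Fin (d k)) (Fin b) ℂ)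
      (hK : ∑ k, (K k).conjTranspose * K k = 1) (P Q : ∀ k, Protocol ι a (d k))
      (h : ∀ k, Extends (P k) (Q k)) : Extends (.snd m d K hK P) (.snd m d K hK Q)

/-- A family of bipartite states is perfectly distinguished by some LOCC protocol with finitely
many rounds. -/
def FiniteLOCCDistinguishable {ι : Type} [DecidableEq ι] {a b : ℕ}
    (ψ : ι → Fin a × Fin b → ℂ) : Prop :=
  ∃ P : Protocol ι a b, ∀ i, P.prob (ψ i) i = 1

/-- A family of bipartite states is perfectly distinguished by some LOCC protocol, with finitely
or infinitely many rounds: an infinite protocol is given by its finite truncations, each of which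
extends the previous one, and it is perfect if the probability of a correct guess tends to `1`. -/
def LOCCDistinguishable {ι : Type} [DecidableEq ι] {a b : ℕ}
    (ψ : ι → Fin a × Fin b → ℂ) : Prop :=
  ∃ P : ℕ → Protocol ι a b, (∀ n, (P n).Extends (P (n + 1))) ∧
    ∀ i, Filter.Tendsto (fun n => (P n).prob (ψ i) i) Filter.atTop (nhds 1)

theorem Protocol.Extends.refl {ι : Type} {a b : ℕ} (P : Protocol ι a b) : P.Extends P := by
  induction P with
  | guess i => exact .guess i _
  | fst m d K hK next ih => exact .fst m d K hK _ _ ih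
  | snd m d K hK next ih => exact .snd m d K hK _ _ ih

theorem FiniteLOCCDistinguishable.loccDistinguishable {ι : Type} [DecidableEq ι] {a b : ℕ}
    {ψ : ι → Fin a × Fin b → ℂ} (h : FiniteLOCCDistinguishable ψ) : LOCCDistinguishable ψ := by
  obtain ⟨P, hP⟩ := h
  exact ⟨fun _ => P, fun _ => .refl P, fun i => by simp [hP i]⟩

/-! ### The states -/

/-- The computational basis vector `|i⟩` of `ℂ^d`. -/
def ket {d : ℕ} (i : Fin d) : Fin d → ℂ := Pi.single i 1

/-- The normalized vector `|i + j⟩`, for `i ≠ j`. -/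
noncomputable def ketAdd {d : ℕ} (i j : Fin d) : Fin d → ℂ :=
  ((Real.sqrt 2 : ℝ) : ℂ)⁻¹ • (ket i + ket j)

/-- The normalized vector `|i - j⟩`, for `i ≠ j`. -/
noncomputable def ketSub {d : ℕ} (i j : Fin d) : Fin d → ℂ :=
  ((Real.sqrt 2 : ℝ) : ℂ)⁻¹ • (ket i - ket j)

/-- `|u⟩|v⟩`. -/
def tensor₂ {a b : ℕ} (u : Fin a → ℂ) (v : Fin b → ℂ) : Fin a × Fin b → ℂ :=
  fun x => u x.1 * v x.2

/-- `|u⟩|v⟩|w⟩`. -/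
def tensor₃ {a b c : ℕ} (u : Fin a → ℂ) (v : Fin b → ℂ) (w : Fin c → ℂ) :
    Fin a × Fin b × Fin c → ℂ :=
  fun x => u x.1 * v x.2.1 * w x.2.2

/-- The ten states `ψ₁, …, ψ₁₀` of `ℂ³ ⊗ ℂ² ⊗ ℂ²` (systems `A`, `B`, `C`); the state `ψᵢ` has
index `i - 1`. -/
noncomputable def state : Fin 10 → Fin 3 × Fin 2 × Fin 2 → ℂ :=
  ![tensor₃ (ketSub 0 1) (ket 0) (ket 0), tensor₃ (ketAdd 0 1) (ket 0) (ket 0),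
    tensor₃ (ketSub 2 0) (ket 1) (ket 0), tensor₃ (ketAdd 2 0) (ket 1) (ket 0),
    tensor₃ (ket 1) (ket 1) (ketSub 0 1), tensor₃ (ket 1) (ket 1) (ketAdd 0 1),
    tensor₃ (ketSub 1 2) (ket 0) (ket 1), tensor₃ (ketAdd 1 2) (ket 0) (ket 1),
    tensor₃ (ket 0) (ketSub 0 1) (ket 1), tensor₃ (ket 0) (ketAdd 0 1) (ket 1)]

/-- The eight domino states of `ℂ³ ⊗ ℂ³`:
`|0⟩|0 ± 1⟩`, `|0 ± 1⟩|2⟩`, `|2⟩|1 ± 2⟩`, `|1 ± 2⟩|0⟩`. -/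
noncomputable def domino : Fin 8 → Fin 3 × Fin 3 → ℂ :=
  ![tensor₂ (ket 0) (ketAdd 0 1), tensor₂ (ket 0) (ketSub 0 1),
    tensor₂ (ketAdd 0 1) (ket 2), tensor₂ (ketSub 0 1) (ket 2),
    tensor₂ (ket 2) (ketAdd 1 2), tensor₂ (ket 2) (ketSub 1 2),
    tensor₂ (ketAdd 1 2) (ket 0), tensor₂ (ketSub 1 2) (ket 0)]

/-- A vector of `ℂ³ ⊗ ℂ³` seen in `ℂ³ ⊗ ℂ⁴`, with `ℂ³` the span of `|0⟩, |1⟩, |2⟩` in `ℂ⁴`. -/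
def embed (v : Fin 3 × Fin 3 → ℂ) : Fin 3 × Fin 4 → ℂ :=
  fun x => if h : (x.2 : ℕ) < 3 then v (x.1, ⟨x.2, h⟩) else 0

/-- The relabelling `ℂ² ⊗ ℂ² ≅ ℂ⁴` of the basis of `BC`:
`|10⟩ ↦ |0⟩`, `|11⟩ ↦ |1⟩`, `|01⟩ ↦ |2⟩`, `|00⟩ ↦ |3⟩`. -/
def relabelBC : Fin 2 × Fin 2 ≃ Fin 4 where
  toFun x := ![![3, 2], ![0, 1]] x.1 x.2
  invFun := ![(1, 0), (1, 1), (0, 1), (0, 0)]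
  left_inv := by decide
  right_inv := by decide

/-! ### The bipartitions

The two systems in one location form a single system, through `Fin m × Fin n ≃ Fin (m * n)`. -/

/-- The vector in the bipartition `A|BC`, in `ℂ³ ⊗ ℂ⁴`. -/
def acrossA_BC (v : Fin 3 × Fin 2 × Fin 2 → ℂ) : Fin 3 × Fin (2 * 2) → ℂ :=
  fun x => let bc := finProdFinEquiv.symm x.2; v (x.1, bc.1, bc.2)

/-- The vector in the bipartition `B|CA`, in `ℂ² ⊗ ℂ⁶`. -/
def acrossB_CA (v : Fin 3 × Fin 2 × Fin 2 → ℂ) : Fin 2 × Fin (2 * 3) → ℂ :=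
  fun x => let ca := finProdFinEquiv.symm x.2; v (ca.2, x.1, ca.1)

/-- The vector in the bipartition `C|AB`, in `ℂ² ⊗ ℂ⁶`. -/
def acrossC_AB (v : Fin 3 × Fin 2 × Fin 2 → ℂ) : Fin 2 × Fin (3 * 2) → ℂ :=
  fun x => let ab := finProdFinEquiv.symm x.2; v (ab.1, ab.2, x.1)

end ProductStates

/-! Distinguishability across `B|CA` and `C|AB`: in either cut, all but two of the states have a
computational basis vector on the single-qubit side. The two exceptions share one basis vector `p`
of the joint side, and `p` is orthogonal to the joint factors of the other eight. Testing for `p`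
therefore disturbs no state. If `p` is found, the qubit is measured in the `±` basis; otherwise it
is measured in the computational basis, and the remaining joint factors are orthonormal
(`finiteLOCCDistinguishable_of_tree`).

Indistinguishability across `A|BC`: in every branch the eight states are the `tileState` of three
vectors `x` on one side and three `y` on the other, the images of basis vectors. The two states of a
pair have overlap with real part proportional to a difference of squared norms, so they stay nearly
orthogonal only while these norms are nearly equal. As long as both triples are balanced, no guess
is good (`le_sum_error_guess`). A measurement that unbalances one triple makes some pair overlap,
and by `Protocol.abs_re_dotProduct_le_error` no continuation repairs this. The product of total
norms is additive over outcomes, so induction on the protocol (`le_sum_error`) bounds the summed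
error below by a positive constant independent of the protocol. This also excludes infinitely many
rounds. -/

namespace ProductStates

open Matrix

/-! ### Inner products and measurements -/

/-- The squared norm of a vector given by its coordinates. -/
noncomputable def sqNorm {κ : Type*} [Fintype κ] (v : κ → ℂ) : ℝ := ∑ x, ‖v x‖ ^ 2

theorem sqNorm_nonneg {κ : Type*} [Fintype κ] (v : κ → ℂ) : 0 ≤ sqNorm v :=
  Finset.sum_nonneg fun _ _ => by positivity

theorem star_dotProduct_self {κ : Type*} [Fintype κ] (v : κ → ℂ) :
    star v ⬝ᵥ v = (sqNorm v : ℂ) := by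
  simp [sqNorm, dotProduct, Complex.conj_mul']

theorem sqNorm_eq_re {κ : Type*} [Fintype κ] (v : κ → ℂ) : sqNorm v = (star v ⬝ᵥ v).re := by
  rw [star_dotProduct_self, Complex.ofReal_re]

/-- Weighted AM-GM, coordinatewise. Unlike Cauchy–Schwarz, the bound is linear in the squared norms
and can be summed over branches. -/
theorem abs_re_dotProduct_le {κ : Type*} [Fintype κ] (v w : κ → ℂ) {s : ℝ} (hs : 0 < s) :
    |(star v ⬝ᵥ w).re| ≤ 1 / (2 * s) * sqNorm v + s / 2 * sqNorm w := by
  rw [sqNorm, sqNorm, Finset.mul_sum, Finset.mul_sum, ← Finset.sum_add_distrib]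
  refine (Complex.abs_re_le_norm _).trans ((norm_sum_le _ _).trans (Finset.sum_le_sum fun x _ => ?_))
  rw [norm_mul, Pi.star_apply, norm_star]
  have h : 1 / (2 * s) * ‖v x‖ ^ 2 + s / 2 * ‖w x‖ ^ 2 - ‖v x‖ * ‖w x‖
      = 1 / (2 * s) * (‖v x‖ - s * ‖w x‖) ^ 2 := by field_simp; ring
  have : 0 ≤ 1 / (2 * s) * (‖v x‖ - s * ‖w x‖) ^ 2 := by positivity
  linarith

theorem re_dotProduct_comm {κ : Type*} [Fintype κ] (v w : κ → ℂ) :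
    (star v ⬝ᵥ w).re = (star w ⬝ᵥ v).re := by
  simp only [dotProduct, Complex.re_sum]
  exact Finset.sum_congr rfl fun x _ => by simp [Complex.mul_re]; ring

theorem sum_dotProduct_mulVec {m a : ℕ} {d : Fin m → ℕ} {K : ∀ k, Matrix (Fin (d k)) (Fin a) ℂ}
    (hK : ∑ k, (K k)ᴴ * K k = 1) (v w : Fin a → ℂ) :
    ∑ k, star (K k *ᵥ v) ⬝ᵥ (K k *ᵥ w) = star v ⬝ᵥ w := by
  simp_rw [star_mulVec, ← dotProduct_mulVec, mulVec_mulVec, ← dotProduct_sum, ← sum_mulVec, hK,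
    one_mulVec]

theorem sum_dotProduct_applyFst {m a b : ℕ} {d : Fin m → ℕ}
    {K : ∀ k, Matrix (Fin (d k)) (Fin a) ℂ} (hK : ∑ k, (K k)ᴴ * K k = 1)
    (v w : Fin a × Fin b → ℂ) :
    ∑ k, star (applyFst (K k) v) ⬝ᵥ applyFst (K k) w = star v ⬝ᵥ w := by
  have h : ∀ {c : ℕ} (v w : Fin c × Fin b → ℂ),
      star v ⬝ᵥ w = ∑ t, star (fun s => v (s, t)) ⬝ᵥ fun s => w (s, t) := fun v w => by
    simp only [dotProduct, Fintype.sum_prod_type]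
    exact Finset.sum_comm
  rw [h v w]
  simp_rw [h (applyFst _ v)]
  rw [Finset.sum_comm]
  exact Finset.sum_congr rfl fun t _ =>
    sum_dotProduct_mulVec hK (fun s => v (s, t)) fun s => w (s, t)

theorem sum_dotProduct_applySnd {m a b : ℕ} {d : Fin m → ℕ}
    {K : ∀ k, Matrix (Fin (d k)) (Fin b) ℂ} (hK : ∑ k, (K k)ᴴ * K k = 1)
    (v w : Fin a × Fin b → ℂ) :
    ∑ k, star (applySnd (K k) v) ⬝ᵥ applySnd (K k) w = star v ⬝ᵥ w := by
  have h : ∀ {c : ℕ} (v w : Fin a × Fin c → ℂ),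
      star v ⬝ᵥ w = ∑ s, star (fun t => v (s, t)) ⬝ᵥ fun t => w (s, t) := fun v w => by
    simp only [dotProduct, Fintype.sum_prod_type]
    rfl
  rw [h v w]
  simp_rw [h (applySnd _ v)]
  rw [Finset.sum_comm]
  exact Finset.sum_congr rfl fun s _ =>
    sum_dotProduct_mulVec hK (fun t => v (s, t)) fun t => w (s, t)

theorem sum_sqNorm_mulVec {m a : ℕ} {d : Fin m → ℕ} {K : ∀ k, Matrix (Fin (d k)) (Fin a) ℂ}
    (hK : ∑ k, (K k)ᴴ * K k = 1) (v : Fin a → ℂ) : ∑ k, sqNorm (K k *ᵥ v) = sqNorm v := by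
  simp_rw [sqNorm_eq_re, ← Complex.re_sum, sum_dotProduct_mulVec hK]

theorem sum_sqNorm_applyFst {m a b : ℕ} {d : Fin m → ℕ} {K : ∀ k, Matrix (Fin (d k)) (Fin a) ℂ}
    (hK : ∑ k, (K k)ᴴ * K k = 1) (v : Fin a × Fin b → ℂ) :
    ∑ k, sqNorm (applyFst (K k) v) = sqNorm v := by
  simp_rw [sqNorm_eq_re, ← Complex.re_sum, sum_dotProduct_applyFst hK]

theorem sum_sqNorm_applySnd {m a b : ℕ} {d : Fin m → ℕ} {K : ∀ k, Matrix (Fin (d k)) (Fin b) ℂ}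
    (hK : ∑ k, (K k)ᴴ * K k = 1) (v : Fin a × Fin b → ℂ) :
    ∑ k, sqNorm (applySnd (K k) v) = sqNorm v := by
  simp_rw [sqNorm_eq_re, ← Complex.re_sum, sum_dotProduct_applySnd hK]

theorem applyFst_tensor₂ {a a' b : ℕ} (K : Matrix (Fin a') (Fin a) ℂ) (u : Fin a → ℂ)
    (v : Fin b → ℂ) : applyFst K (tensor₂ u v) = tensor₂ (K *ᵥ u) v := by
  ext x
  simp [applyFst, tensor₂, mulVec, dotProduct, Finset.sum_mul, mul_assoc]

theorem applySnd_tensor₂ {a b b' : ℕ} (K : Matrix (Fin b') (Fin b) ℂ) (u : Fin a → ℂ)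
    (v : Fin b → ℂ) : applySnd K (tensor₂ u v) = tensor₂ u (K *ᵥ v) := by
  ext x
  simp [applySnd, tensor₂, mulVec, dotProduct, Finset.mul_sum, mul_left_comm]

theorem dotProduct_tensor₂ {a b : ℕ} (u u' : Fin a → ℂ) (v v' : Fin b → ℂ) :
    star (tensor₂ u v) ⬝ᵥ tensor₂ u' v' = (star u ⬝ᵥ u') * (star v ⬝ᵥ v') := by
  simp only [dotProduct, tensor₂, Fintype.sum_prod_type, Finset.sum_mul_sum, Pi.star_apply,
    star_mul']
  exact Finset.sum_congr rfl fun x _ => Finset.sum_congr rfl fun y _ => by ring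

theorem sqNorm_tensor₂ {a b : ℕ} (u : Fin a → ℂ) (v : Fin b → ℂ) :
    sqNorm (tensor₂ u v) = sqNorm u * sqNorm v := by
  rw [sqNorm_eq_re, dotProduct_tensor₂, star_dotProduct_self, star_dotProduct_self,
    ← Complex.ofReal_mul, Complex.ofReal_re]

/-! ### The probability of an error -/

theorem Protocol.prob_nonneg {ι : Type} [DecidableEq ι] {a b : ℕ} (P : Protocol ι a b)
    (v : Fin a × Fin b → ℂ) (i : ι) : 0 ≤ P.prob v i := by
  induction P with
  | guess j =>
    simp only [Protocol.prob]
    split_ifs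
    exacts [sqNorm_nonneg v, le_rfl]
  | fst m d K hK next ih => exact Finset.sum_nonneg fun k _ => ih k _
  | snd m d K hK next ih => exact Finset.sum_nonneg fun k _ => ih k _

theorem Protocol.prob_guess {ι : Type} [DecidableEq ι] {a b : ℕ} (i j : ι)
    (v : Fin a × Fin b → ℂ) :
    (Protocol.guess j : Protocol ι a b).prob v i = if j = i then sqNorm v else 0 := rfl

/-- The probability that the protocol, run on `v`, ends with a guess other than `i`. -/
noncomputable def Protocol.error {ι : Type} [DecidableEq ι] {a b : ℕ} (P : Protocol ι a b)
    (v : Fin a × Fin b → ℂ) (i : ι) : ℝ := sqNorm v - P.prob v i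

theorem Protocol.error_guess {ι : Type} [DecidableEq ι] {a b : ℕ} (i j : ι)
    (v : Fin a × Fin b → ℂ) :
    (Protocol.guess j : Protocol ι a b).error v i = if j = i then 0 else sqNorm v := by
  rw [error, prob_guess]
  split_ifs <;> simp

/-- The squared norm is additive over outcomes by completeness of the measurement, the probability
by definition. -/
theorem Protocol.error_fst {ι : Type} [DecidableEq ι] {a b m : ℕ} {d : Fin m → ℕ}
    {K : ∀ k, Matrix (Fin (d k)) (Fin a) ℂ} (hK : ∑ k, (K k)ᴴ * K k = 1)
    (next : ∀ k, Protocol ι (d k) b) (v : Fin a × Fin b → ℂ) (i : ι) :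
    (Protocol.fst m d K hK next).error v i = ∑ k, (next k).error (applyFst (K k) v) i := by
  simp only [error, Finset.sum_sub_distrib, sum_sqNorm_applyFst hK]
  rfl

theorem Protocol.error_snd {ι : Type} [DecidableEq ι] {a b m : ℕ} {d : Fin m → ℕ}
    {K : ∀ k, Matrix (Fin (d k)) (Fin b) ℂ} (hK : ∑ k, (K k)ᴴ * K k = 1)
    (next : ∀ k, Protocol ι a (d k)) (v : Fin a × Fin b → ℂ) (i : ι) :
    (Protocol.snd m d K hK next).error v i = ∑ k, (next k).error (applySnd (K k) v) i := by
  simp only [error, Finset.sum_sub_distrib, sum_sqNorm_applySnd hK]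
  rfl

theorem Protocol.error_nonneg {ι : Type} [DecidableEq ι] {a b : ℕ} (P : Protocol ι a b)
    (v : Fin a × Fin b → ℂ) (i : ι) : 0 ≤ P.error v i := by
  induction P with
  | guess j =>
    rw [error_guess]
    split_ifs
    exacts [le_rfl, sqNorm_nonneg v]
  | fst m d K hK next ih => rw [error_fst]; exact Finset.sum_nonneg fun k _ => ih k _
  | snd m d K hK next ih => rw [error_snd]; exact Finset.sum_nonneg fun k _ => ih k _

/-- Two states with a large overlap are not distinguished well by any protocol. -/
theorem Protocol.abs_re_dotProduct_le_error {ι : Type} [DecidableEq ι] {a b : ℕ}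
    (P : Protocol ι a b) (v w : Fin a × Fin b → ℂ) {i j : ι} (hij : i ≠ j) {s : ℝ} (hs : 0 < s) :
    |(star v ⬝ᵥ w).re| ≤
      1 / (2 * s) * (P.error v i + P.error w j) + s / 2 * (sqNorm v + sqNorm w) := by
  induction P with
  | guess l =>
    have hv : 0 ≤ s / 2 * sqNorm v := mul_nonneg (by positivity) (sqNorm_nonneg v)
    have hw : 0 ≤ s / 2 * sqNorm w := mul_nonneg (by positivity) (sqNorm_nonneg w)
    have hv' : 0 ≤ 1 / (2 * s) * sqNorm v := mul_nonneg (by positivity) (sqNorm_nonneg v)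
    rw [error_guess, error_guess]
    -- A guess is wrong for at least one of the two states, and the whole norm of that state is
    -- error. AM-GM is applied with the weight `1 / (2 * s)` on that state.
    rcases eq_or_ne l i with rfl | hl
    · have h := abs_re_dotProduct_le w v hs
      rw [re_dotProduct_comm, if_pos rfl, if_neg hij]
      linarith
    · have h := abs_re_dotProduct_le v w hs
      rw [if_neg hl]
      split_ifs <;> linarith [mul_nonneg (by positivity : 0 ≤ 1 / (2 * s)) (sqNorm_nonneg w)]
  | fst m d K hK next ih =>
    rw [error_fst, error_fst, ← sum_dotProduct_applyFst hK, ← sum_sqNorm_applyFst hK v,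
      ← sum_sqNorm_applyFst hK w, ← Finset.sum_add_distrib, ← Finset.sum_add_distrib,
      Finset.mul_sum, Finset.mul_sum, ← Finset.sum_add_distrib, Complex.re_sum]
    exact (Finset.abs_sum_le_sum_abs _ _).trans (Finset.sum_le_sum fun k _ => ih k _ _)
  | snd m d K hK next ih =>
    rw [error_snd, error_snd, ← sum_dotProduct_applySnd hK, ← sum_sqNorm_applySnd hK v,
      ← sum_sqNorm_applySnd hK w, ← Finset.sum_add_distrib, ← Finset.sum_add_distrib,
      Finset.mul_sum, Finset.mul_sum, ← Finset.sum_add_distrib, Complex.re_sum]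
    exact (Finset.abs_sum_le_sum_abs _ _).trans (Finset.sum_le_sum fun k _ => ih k _ _)

/-! ### A lower bound for the error of discriminating the domino states -/

theorem inv_sqrt_two_mul_self :
    ((Real.sqrt 2 : ℝ) : ℂ)⁻¹ * ((Real.sqrt 2 : ℝ) : ℂ)⁻¹ = 1 / 2 := by
  rw [← mul_inv, ← Complex.ofReal_mul, Real.mul_self_sqrt (by norm_num)]
  norm_num

/-- `(u + v) / √2`. -/
noncomputable def halfAdd {κ : Type*} (u v : κ → ℂ) : κ → ℂ :=
  ((Real.sqrt 2 : ℝ) : ℂ)⁻¹ • (u + v)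

/-- `(u - v) / √2`. -/
noncomputable def halfSub {κ : Type*} (u v : κ → ℂ) : κ → ℂ :=
  ((Real.sqrt 2 : ℝ) : ℂ)⁻¹ • (u - v)

theorem mulVec_halfAdd {a a' : ℕ} (K : Matrix (Fin a') (Fin a) ℂ) (u v : Fin a → ℂ) :
    K *ᵥ halfAdd u v = halfAdd (K *ᵥ u) (K *ᵥ v) := by
  rw [halfAdd, halfAdd, mulVec_smul, mulVec_add]

theorem mulVec_halfSub {a a' : ℕ} (K : Matrix (Fin a') (Fin a) ℂ) (u v : Fin a → ℂ) :
    K *ᵥ halfSub u v = halfSub (K *ᵥ u) (K *ᵥ v) := by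
  rw [halfSub, halfSub, mulVec_smul, mulVec_sub]

section

variable {κ : Type*} [Fintype κ] (u v u' v' : κ → ℂ)

theorem star_smul_dotProduct_smul :
    star (((Real.sqrt 2 : ℝ) : ℂ)⁻¹ • u) ⬝ᵥ (((Real.sqrt 2 : ℝ) : ℂ)⁻¹ • v) =
      1 / 2 * (star u ⬝ᵥ v) := by
  rw [star_smul, smul_dotProduct, dotProduct_smul, smul_eq_mul, smul_eq_mul, ← mul_assoc,
    ← inv_sqrt_two_mul_self, star_inv₀]
  simp

/-- The cross terms are conjugate with opposite signs, so their real parts cancel. This turns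
imbalance of norms into overlap. -/
theorem halfSub_dotProduct_halfAdd_re :
    (star (halfSub u v) ⬝ᵥ halfAdd u v).re = (sqNorm u - sqNorm v) / 2 := by
  have h := re_dotProduct_comm u v
  rw [halfSub, halfAdd, star_smul_dotProduct_smul, star_sub, sub_dotProduct, dotProduct_add,
    dotProduct_add, sqNorm_eq_re, sqNorm_eq_re]
  simp [Complex.mul_re, h]
  ring

/-- The parallelogram law. -/
theorem sqNorm_halfSub_add_sqNorm_halfAdd :
    sqNorm (halfSub u v) + sqNorm (halfAdd u v) = sqNorm u + sqNorm v := by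
  rw [sqNorm_eq_re, sqNorm_eq_re, sqNorm_eq_re, sqNorm_eq_re, halfSub, halfAdd,
    star_smul_dotProduct_smul, star_smul_dotProduct_smul, star_sub, star_add, sub_dotProduct,
    add_dotProduct]
  simp only [dotProduct_sub, dotProduct_add]
  simp [Complex.mul_re]
  ring

end

theorem le_error_add_error {ι : Type} [DecidableEq ι] {a b : ℕ} (P : Protocol ι a b)
    {v w : Fin a × Fin b → ℂ} {i j : ι} (hij : i ≠ j) {T : ℝ} (h : sqNorm v + sqNorm w ≤ T)
    (h' : T / 96 ≤ |(star v ⬝ᵥ w).re|) : T / 9216 ≤ P.error v i + P.error w j := by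
  -- With `s = 1 / 96` the norm term is at most `T / 192`, half of the overlap; the other half is at
  -- most `48` times the error, and `192 * 48 = 9216`.
  have := P.abs_re_dotProduct_le_error v w hij (s := 1 / 96) (by norm_num)
  linarith

/-- The overlap is half the norm difference times `sqNorm w`, hence at least `X / 24 * (Y / 4) = X *
Y / 96`. -/
theorem le_error_fst {ι : Type} [DecidableEq ι] {a b : ℕ} (P : Protocol ι a b)
    (u v : Fin a → ℂ) (w : Fin b → ℂ) {i j : ι} (hij : i ≠ j) {X Y : ℝ}
    (h : sqNorm u + sqNorm v ≤ X) (h' : X / 12 ≤ |sqNorm u - sqNorm v|)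
    (hw : sqNorm w ≤ Y) (hw' : Y / 4 ≤ sqNorm w) :
    X * Y / 9216 ≤ P.error (tensor₂ (halfSub u v) w) i + P.error (tensor₂ (halfAdd u v) w) j := by
  have hX : 0 ≤ X := by linarith [sqNorm_nonneg u, sqNorm_nonneg v]
  have hY : 0 ≤ Y := by linarith [sqNorm_nonneg w]
  apply le_error_add_error P hij
  · rw [sqNorm_tensor₂, sqNorm_tensor₂, ← add_mul, sqNorm_halfSub_add_sqNorm_halfAdd]
    exact mul_le_mul h hw (sqNorm_nonneg w) hX
  · rw [dotProduct_tensor₂, star_dotProduct_self, Complex.re_mul_ofReal,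
      halfSub_dotProduct_halfAdd_re, abs_mul, abs_of_nonneg (sqNorm_nonneg w), abs_div, abs_two]
    have := mul_le_mul h' hw' (by positivity) (abs_nonneg _)
    linarith

theorem le_error_snd {ι : Type} [DecidableEq ι] {a b : ℕ} (P : Protocol ι a b)
    (u v : Fin b → ℂ) (w : Fin a → ℂ) {i j : ι} (hij : i ≠ j) {X Y : ℝ}
    (h : sqNorm u + sqNorm v ≤ Y) (h' : Y / 12 ≤ |sqNorm u - sqNorm v|)
    (hw : sqNorm w ≤ X) (hw' : X / 4 ≤ sqNorm w) :
    X * Y / 9216 ≤ P.error (tensor₂ w (halfSub u v)) i + P.error (tensor₂ w (halfAdd u v)) j := by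
  have hY : 0 ≤ Y := by linarith [sqNorm_nonneg u, sqNorm_nonneg v]
  have hX : 0 ≤ X := by linarith [sqNorm_nonneg w]
  apply le_error_add_error P hij
  · rw [sqNorm_tensor₂, sqNorm_tensor₂, ← mul_add, sqNorm_halfSub_add_sqNorm_halfAdd]
    exact mul_le_mul hw h (add_nonneg (sqNorm_nonneg u) (sqNorm_nonneg v)) hX
  · rw [dotProduct_tensor₂, star_dotProduct_self, Complex.re_ofReal_mul,
      halfSub_dotProduct_halfAdd_re, abs_mul, abs_of_nonneg (sqNorm_nonneg w), abs_div, abs_two]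
    have := mul_le_mul hw' h' (by positivity) (sqNorm_nonneg w)
    linarith

/-- The images of the eight states `ψ₃, …, ψ₁₀` under a product map that takes `|s⟩` in `A` to
`x s` and `|10⟩, |11⟩, |01⟩` in `BC` to `y 0, y 1, y 2`. -/
noncomputable def tileState {a b : ℕ} (x : Fin 3 → Fin a → ℂ) (y : Fin 3 → Fin b → ℂ) :
    Fin 8 → Fin a × Fin b → ℂ :=
  ![tensor₂ (halfSub (x 2) (x 0)) (y 0), tensor₂ (halfAdd (x 2) (x 0)) (y 0),
    tensor₂ (x 1) (halfSub (y 0) (y 1)), tensor₂ (x 1) (halfAdd (y 0) (y 1)),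
    tensor₂ (halfSub (x 1) (x 2)) (y 2), tensor₂ (halfAdd (x 1) (x 2)) (y 2),
    tensor₂ (x 0) (halfSub (y 2) (y 1)), tensor₂ (x 0) (halfAdd (y 2) (y 1))]

theorem applyFst_tileState {a a' b : ℕ} (K : Matrix (Fin a') (Fin a) ℂ) (x : Fin 3 → Fin a → ℂ)
    (y : Fin 3 → Fin b → ℂ) (j : Fin 8) :
    applyFst K (tileState x y j) = tileState (fun s => K *ᵥ x s) y j := by
  fin_cases j <;> simp [tileState, applyFst_tensor₂, mulVec_halfAdd, mulVec_halfSub]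

theorem applySnd_tileState {a b b' : ℕ} (K : Matrix (Fin b') (Fin b) ℂ) (x : Fin 3 → Fin a → ℂ)
    (y : Fin 3 → Fin b → ℂ) (j : Fin 8) :
    applySnd K (tileState x y j) = tileState x (fun s => K *ᵥ y s) j := by
  fin_cases j <;> simp [tileState, applySnd_tensor₂, mulVec_halfAdd, mulVec_halfSub]

/-- The sum of the squared norms of three vectors. -/
noncomputable def totalNorm {a : ℕ} (x : Fin 3 → Fin a → ℂ) : ℝ :=
  sqNorm (x 0) + sqNorm (x 1) + sqNorm (x 2)

theorem totalNorm_nonneg {a : ℕ} (x : Fin 3 → Fin a → ℂ) : 0 ≤ totalNorm x :=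
  add_nonneg (add_nonneg (sqNorm_nonneg _) (sqNorm_nonneg _)) (sqNorm_nonneg _)

theorem sum_totalNorm_mulVec {m a : ℕ} {d : Fin m → ℕ} {K : ∀ k, Matrix (Fin (d k)) (Fin a) ℂ}
    (hK : ∑ k, (K k)ᴴ * K k = 1) (x : Fin 3 → Fin a → ℂ) :
    ∑ k, totalNorm (fun s => K k *ᵥ x s) = totalNorm x := by
  simp only [totalNorm, Finset.sum_add_distrib, sum_sqNorm_mulVec hK]

/-- Three vectors whose squared norms differ little, compared with their sum; `i` is the index of
the vector with which the two others are compared. -/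
def Balanced {a : ℕ} (x : Fin 3 → Fin a → ℂ) (i : Fin 3) : Prop :=
  ∀ s, |sqNorm (x i) - sqNorm (x s)| < totalNorm x / 12 ∨ s = i

/-- Let `T` be the total and `δ`, `δ'` the reference norm minus each of the two others, both below
`T / 12` in absolute value. The norm belonging to `δ` is `T / 3 - 2 * δ / 3 + δ' / 3`, hence at
least `T / 4`; the reference norm is `(T + δ + δ') / 3`, which is larger still than `T / 4`. -/
theorem Balanced.totalNorm_le {a : ℕ} {x : Fin 3 → Fin a → ℂ} {i : Fin 3} (h : Balanced x i)
    (s : Fin 3) : totalNorm x / 4 ≤ sqNorm (x s) := by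
  have h0 := h 0
  have h1 := h 1
  have h2 := h 2
  have := totalNorm_nonneg x
  simp only [totalNorm, abs_lt] at *
  fin_cases i <;> simp at h0 h1 h2 <;> fin_cases s <;> simp <;> linarith

theorem sqNorm_le_totalNorm {a : ℕ} (x : Fin 3 → Fin a → ℂ) (s : Fin 3) :
    sqNorm (x s) ≤ totalNorm x := by
  have h0 := sqNorm_nonneg (x 0)
  have h1 := sqNorm_nonneg (x 1)
  have h2 := sqNorm_nonneg (x 2)
  rw [totalNorm]
  fin_cases s <;> simp <;> linarith

theorem sqNorm_add_le_totalNorm {a : ℕ} (x : Fin 3 → Fin a → ℂ) {s t : Fin 3} (hst : s ≠ t) :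
    sqNorm (x s) + sqNorm (x t) ≤ totalNorm x := by
  have h0 := sqNorm_nonneg (x 0)
  have h1 := sqNorm_nonneg (x 1)
  have h2 := sqNorm_nonneg (x 2)
  rw [totalNorm]
  fin_cases s <;> fin_cases t <;> simp at hst ⊢ <;> linarith

/-! ### Induction on the protocol -/

section

variable {ι : Type} [DecidableEq ι] {a b : ℕ} (P : Protocol ι a b) {e : Fin 8 → ι}
  (he : Function.Injective e) {x : Fin 3 → Fin a → ℂ} {y : Fin 3 → Fin b → ℂ}

include he

/-- The pairs that superpose vectors of `x` use the indices `2, 0` and `1, 2`, which is why `2` is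
the reference index. Imbalance makes one of these pairs overlap, and the balance of `y` keeps its
other factor from being small. -/
theorem le_sum_error_of_not_balanced_fst (hx : ¬ Balanced x 2) (hy : Balanced y 1) :
    totalNorm x * totalNorm y / 9216 ≤ ∑ j, P.error (tileState x y j) (e j) := by
  have hne : ∀ i j, i ≠ j → e i ≠ e j := fun i j h => he.ne h
  have h0 := fun j => P.error_nonneg (tileState x y j) (e j)
  simp only [Balanced, not_forall, not_or, not_lt] at hx
  obtain ⟨s, hs, hs2⟩ := hx
  have hs' : s = 0 ∨ s = 1 := by lia
  rw [Fin.sum_univ_eight]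
  rcases hs' with rfl | rfl
  · have h : _ ≤ P.error (tileState x y 0) (e 0) + P.error (tileState x y 1) (e 1) :=
      le_error_fst P (x 2) (x 0) (y 0) (hne 0 1 (by decide))
        (sqNorm_add_le_totalNorm x (by decide)) hs (sqNorm_le_totalNorm y 0) (hy.totalNorm_le 0)
    linarith [h0 2, h0 3, h0 4, h0 5, h0 6, h0 7]
  · have h : _ ≤ P.error (tileState x y 4) (e 4) + P.error (tileState x y 5) (e 5) :=
      le_error_fst P (x 1) (x 2) (y 2) (hne 4 5 (by decide))
        (sqNorm_add_le_totalNorm x (by decide)) (by rwa [abs_sub_comm])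
        (sqNorm_le_totalNorm y 2) (hy.totalNorm_le 2)
    linarith [h0 0, h0 1, h0 2, h0 3, h0 6, h0 7]

/-- Here the superposed pairs are `0, 1` and `2, 1`, so the reference index is `1`. -/
theorem le_sum_error_of_not_balanced_snd (hx : Balanced x 2) (hy : ¬ Balanced y 1) :
    totalNorm x * totalNorm y / 9216 ≤ ∑ j, P.error (tileState x y j) (e j) := by
  have hne : ∀ i j, i ≠ j → e i ≠ e j := fun i j h => he.ne h
  have h0 := fun j => P.error_nonneg (tileState x y j) (e j)
  simp only [Balanced, not_forall, not_or, not_lt] at hy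
  obtain ⟨s, hs, hs2⟩ := hy
  have hs' : s = 0 ∨ s = 2 := by lia
  rw [Fin.sum_univ_eight]
  rcases hs' with rfl | rfl
  · have h : _ ≤ P.error (tileState x y 2) (e 2) + P.error (tileState x y 3) (e 3) :=
      le_error_snd P (y 0) (y 1) (x 1) (hne 2 3 (by decide))
        (sqNorm_add_le_totalNorm y (by decide)) (by rwa [abs_sub_comm])
        (sqNorm_le_totalNorm x 1) (hx.totalNorm_le 1)
    linarith [h0 0, h0 1, h0 4, h0 5, h0 6, h0 7]
  · have h : _ ≤ P.error (tileState x y 6) (e 6) + P.error (tileState x y 7) (e 7) :=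
      le_error_snd P (y 2) (y 1) (x 0) (hne 6 7 (by decide))
        (sqNorm_add_le_totalNorm y (by decide)) (by rwa [abs_sub_comm])
        (sqNorm_le_totalNorm x 0) (hx.totalNorm_le 0)
    linarith [h0 0, h0 1, h0 2, h0 3, h0 4, h0 5]

/-- A single guess misses entirely either the pair `0, 1` or the pair `2, 3`, and balance bounds the
norm of that pair from below. -/
theorem le_sum_error_guess (i : ι) (hx : Balanced x 2) (hy : Balanced y 1) :
    totalNorm x * totalNorm y / 9216 ≤
      ∑ j, (Protocol.guess i : Protocol ι a b).error (tileState x y j) (e j) := by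
  have hne : ∀ i j, i ≠ j → e i ≠ e j := fun i j h => he.ne h
  have h0 := fun j => (Protocol.guess i : Protocol ι a b).error_nonneg (tileState x y j) (e j)
  have hX := totalNorm_nonneg x
  have hY := totalNorm_nonneg y
  have hXY := mul_nonneg hX hY
  have key : ∀ s t, totalNorm x / 4 * (totalNorm y / 4) ≤ sqNorm (x s) * sqNorm (y t) := fun s t =>
    mul_le_mul (hx.totalNorm_le s) (hy.totalNorm_le t) (by positivity) (sqNorm_nonneg _)
  rw [Fin.sum_univ_eight]
  by_cases h : i = e 0 ∨ i = e 1
  · have h2 : i ≠ e 2 := by rcases h with rfl | rfl <;> exact hne _ _ (by decide)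
    have h3 : i ≠ e 3 := by rcases h with rfl | rfl <;> exact hne _ _ (by decide)
    have e2 : (Protocol.guess i : Protocol ι a b).error (tileState x y 2) (e 2) =
        sqNorm (x 1) * sqNorm (halfSub (y 0) (y 1)) := by
      rw [Protocol.error_guess, if_neg h2, ← sqNorm_tensor₂]; rfl
    have e3 : (Protocol.guess i : Protocol ι a b).error (tileState x y 3) (e 3) =
        sqNorm (x 1) * sqNorm (halfAdd (y 0) (y 1)) := by
      rw [Protocol.error_guess, if_neg h3, ← sqNorm_tensor₂]; rfl
    have hs := congrArg (sqNorm (x 1) * ·) (sqNorm_halfSub_add_sqNorm_halfAdd (y 0) (y 1))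
    simp only [mul_add] at hs
    linarith [h0 0, h0 1, h0 4, h0 5, h0 6, h0 7, key 1 0, key 1 1]
  · push Not at h
    have e0 : (Protocol.guess i : Protocol ι a b).error (tileState x y 0) (e 0) =
        sqNorm (halfSub (x 2) (x 0)) * sqNorm (y 0) := by
      rw [Protocol.error_guess, if_neg h.1, ← sqNorm_tensor₂]; rfl
    have e1 : (Protocol.guess i : Protocol ι a b).error (tileState x y 1) (e 1) =
        sqNorm (halfAdd (x 2) (x 0)) * sqNorm (y 0) := by
      rw [Protocol.error_guess, if_neg h.2, ← sqNorm_tensor₂]; rfl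
    have hs := congrArg (· * sqNorm (y 0)) (sqNorm_halfSub_add_sqNorm_halfAdd (x 2) (x 0))
    simp only [add_mul] at hs
    linarith [h0 2, h0 3, h0 4, h0 5, h0 6, h0 7, key 2 0, key 0 0]

/-- While both local systems are balanced a protocol is far from finished, and a measurement
that destroys the balance makes the two states of some pair overlap. -/
theorem le_sum_error (hx : Balanced x 2) (hy : Balanced y 1) :
    totalNorm x * totalNorm y / 9216 ≤ ∑ j, P.error (tileState x y j) (e j) := by
  induction P with
  | guess i => exact le_sum_error_guess he i hx hy
  | fst m d K hK next ih =>
    simp_rw [Protocol.error_fst, applyFst_tileState]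
    rw [Finset.sum_comm, ← sum_totalNorm_mulVec hK, Finset.sum_mul, Finset.sum_div]
    refine Finset.sum_le_sum fun k _ => ?_
    -- Only the measured side changes, so `y` is still balanced when the new triple on the first
    -- side is not.
    by_cases h : Balanced (fun s => K k *ᵥ x s) 2
    · exact ih k h hy
    · exact le_sum_error_of_not_balanced_fst (next k) he h hy
  | snd m d K hK next ih =>
    simp_rw [Protocol.error_snd, applySnd_tileState]
    rw [Finset.sum_comm, ← sum_totalNorm_mulVec hK, Finset.mul_sum, Finset.sum_div]
    refine Finset.sum_le_sum fun k _ => ?_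
    by_cases h : Balanced (fun s => K k *ᵥ y s) 1
    · exact ih k hx h
    · exact le_sum_error_of_not_balanced_snd (next k) he hx h

end

/-- Initially both totals are `3`, so the summed error is at least `9 / 9216` for every `P n`,
whereas perfect discrimination would make it tend to `0`. -/
theorem not_loccDistinguishable_of_tileState {ι : Type} [DecidableEq ι] {a b : ℕ}
    {ψ : ι → Fin a × Fin b → ℂ} {e : Fin 8 → ι} (he : Function.Injective e)
    {x : Fin 3 → Fin a → ℂ} {y : Fin 3 → Fin b → ℂ} (hψ : ∀ j, ψ (e j) = tileState x y j)
    (hx : ∀ s, sqNorm (x s) = 1) (hy : ∀ s, sqNorm (y s) = 1)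
    (hu : ∀ j, sqNorm (tileState x y j) = 1) : ¬ LOCCDistinguishable ψ := by
  rintro ⟨P, -, hP⟩
  have hX : totalNorm x = 3 := by rw [totalNorm, hx, hx, hx]; norm_num
  have hY : totalNorm y = 3 := by rw [totalNorm, hy, hy, hy]; norm_num
  have hlim : Filter.Tendsto (fun n => ∑ j, (P n).error (tileState x y j) (e j)) Filter.atTop
      (nhds (∑ j : Fin 8, (1 - 1))) := by
    refine tendsto_finsetSum _ fun j _ => ?_
    have := (hP (e j)).const_sub 1
    simpa only [Protocol.error, hu, hψ] using this
  have := ge_of_tendsto' hlim fun n => le_sum_error (P n) he (x := x) (y := y)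
    (fun s => Or.inl (by rw [hx, hx, hX]; norm_num))
    (fun s => Or.inl (by rw [hy, hy, hY]; norm_num))
  rw [hX, hY] at this
  norm_num at this

/-! ### Projective measurements -/

theorem Protocol.prob_le_sqNorm {ι : Type} [DecidableEq ι] {a b : ℕ} (P : Protocol ι a b)
    (v : Fin a × Fin b → ℂ) (i : ι) : P.prob v i ≤ sqNorm v :=
  sub_nonneg.mp (P.error_nonneg v i)

/-- If one branch carries the whole norm, the others have norm zero and contribute no probability.
-/
theorem Protocol.sum_prob_eq_of_sqNorm {ι : Type} [DecidableEq ι] {m a b : ℕ}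
    (next : Fin m → Protocol ι a b) (v : Fin m → Fin a × Fin b → ℂ) (i : ι) (k : Fin m)
    (h : ∑ l, sqNorm (v l) = sqNorm (v k)) :
    ∑ l, (next l).prob (v l) i = (next k).prob (v k) i := by
  rw [← Finset.add_sum_erase _ _ (Finset.mem_univ k)] at h ⊢
  refine add_eq_left.mpr (Finset.sum_eq_zero fun l hl => ?_)
  have h0 := (Finset.sum_eq_zero_iff_of_nonneg fun l _ => sqNorm_nonneg (v l)).mp
    (add_eq_left.mp h) l hl
  exact le_antisymm (h0 ▸ (next l).prob_le_sqNorm (v l) i) ((next l).prob_nonneg _ _)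

theorem Protocol.prob_fst_of_fixed {ι : Type} [DecidableEq ι] {m a b : ℕ}
    {K : Fin m → Matrix (Fin a) (Fin a) ℂ} (hK : ∑ k, (K k)ᴴ * K k = 1)
    (next : Fin m → Protocol ι a b) (u : Fin a → ℂ) (w : Fin b → ℂ) (i : ι) (k : Fin m)
    (h : K k *ᵥ u = u) :
    (Protocol.fst m (fun _ => a) K hK next).prob (tensor₂ u w) i =
      (next k).prob (tensor₂ u w) i := by
  have hk : applyFst (K k) (tensor₂ u w) = tensor₂ u w := by rw [applyFst_tensor₂, h]
  have := Protocol.sum_prob_eq_of_sqNorm next (fun l => applyFst (K l) (tensor₂ u w)) i k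
    (by rw [hk, sum_sqNorm_applyFst (d := fun _ => a) hK])
  rwa [hk] at this

theorem Protocol.prob_snd_of_fixed {ι : Type} [DecidableEq ι] {m a b : ℕ}
    {K : Fin m → Matrix (Fin b) (Fin b) ℂ} (hK : ∑ k, (K k)ᴴ * K k = 1)
    (next : Fin m → Protocol ι a b) (u : Fin a → ℂ) (w : Fin b → ℂ) (i : ι) (k : Fin m)
    (h : K k *ᵥ w = w) :
    (Protocol.snd m (fun _ => b) K hK next).prob (tensor₂ u w) i =
      (next k).prob (tensor₂ u w) i := by
  have hk : applySnd (K k) (tensor₂ u w) = tensor₂ u w := by rw [applySnd_tensor₂, h]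
  have := Protocol.sum_prob_eq_of_sqNorm next (fun l => applySnd (K l) (tensor₂ u w)) i k
    (by rw [hk, sum_sqNorm_applySnd (d := fun _ => b) hK])
  rwa [hk] at this

/-- A family of coordinate vectors is orthonormal. -/
def IsOrthonormal {n κ : Type*} [Fintype n] [DecidableEq κ] (w : κ → n → ℂ) : Prop :=
  ∀ k l, star (w k) ⬝ᵥ w l = if k = l then 1 else 0

section

variable {m a : ℕ} {w : Fin m → Fin a → ℂ}

/-- The projections onto the members of an orthonormal family, preceded by the projection onto the
orthogonal complement of its span. -/
noncomputable def projections (w : Fin m → Fin a → ℂ) :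
    Fin (m + 1) → Matrix (Fin a) (Fin a) ℂ :=
  Fin.cons (1 - ∑ k, vecMulVec (w k) (star (w k))) fun k => vecMulVec (w k) (star (w k))

theorem sum_projections (hw : IsOrthonormal w) :
    ∑ k, (projections w k)ᴴ * projections w k = 1 := by
  have hP : ∀ k l, vecMulVec (w k) (star (w k)) * vecMulVec (w l) (star (w l)) =
      if k = l then vecMulVec (w k) (star (w k)) else 0 := fun k l => by
    rw [vecMulVec_mul_vecMulVec, hw k l]
    split_ifs with h
    · rw [one_smul, h]
    · rw [zero_smul, vecMulVec_zero]
  have hH : ∀ k, (vecMulVec (w k) (star (w k)))ᴴ = vecMulVec (w k) (star (w k)) := fun k => by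
    rw [conjTranspose_vecMulVec, star_star]
  have hS : (∑ k, vecMulVec (w k) (star (w k))) * ∑ k, vecMulVec (w k) (star (w k)) =
      ∑ k, vecMulVec (w k) (star (w k)) := by
    simp only [Finset.sum_mul_sum, hP, Finset.sum_ite_eq, Finset.mem_univ, if_true]
  rw [Fin.sum_univ_succ]
  simp only [projections, Fin.cons_zero, Fin.cons_succ, conjTranspose_sub, conjTranspose_sum,
    conjTranspose_one, hH, hP, if_true]
  rw [sub_mul, mul_sub, mul_sub, hS]
  simp

theorem projections_succ_mulVec (hw : IsOrthonormal w) (k : Fin m) :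
    projections w k.succ *ᵥ w k = w k := by
  rw [projections, Fin.cons_succ, vecMulVec_mulVec, hw, if_pos rfl]
  simp

theorem projections_zero_mulVec {v : Fin a → ℂ} (hv : ∀ k, star (w k) ⬝ᵥ v = 0) :
    projections w 0 *ᵥ v = v := by
  simp [projections, sub_mulVec, sum_mulVec, vecMulVec_mulVec, hv]

end

/-- Such a measurement leaves intact every product state whose first factor belongs to the family or
is orthogonal to it; it only selects the continuation. -/
theorem exists_protocol_fst {ι : Type} [DecidableEq ι] {m a b : ℕ} {w : Fin m → Fin a → ℂ}
    (hw : IsOrthonormal w) (Q : Fin m → Protocol ι a b) (R : Protocol ι a b) :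
    ∃ P : Protocol ι a b,
      (∀ k v i, P.prob (tensor₂ (w k) v) i = (Q k).prob (tensor₂ (w k) v) i) ∧
      ∀ u v i, (∀ k, star (w k) ⬝ᵥ u = 0) → P.prob (tensor₂ u v) i = R.prob (tensor₂ u v) i := by
  let next : Fin (m + 1) → Protocol ι a b := Fin.cons R Q
  refine ⟨.fst (m + 1) (fun _ => a) (projections w) (sum_projections hw) next,
    fun k v i => ?_, fun u v i h => ?_⟩
  · exact Protocol.prob_fst_of_fixed _ next _ v i k.succ (projections_succ_mulVec hw k)
  · exact Protocol.prob_fst_of_fixed _ next _ v i 0 (projections_zero_mulVec h)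

theorem exists_protocol_snd {ι : Type} [DecidableEq ι] {m a b : ℕ} {w : Fin m → Fin b → ℂ}
    (hw : IsOrthonormal w) (Q : Fin m → Protocol ι a b) (R : Protocol ι a b) :
    ∃ P : Protocol ι a b,
      (∀ k u i, P.prob (tensor₂ u (w k)) i = (Q k).prob (tensor₂ u (w k)) i) ∧
      ∀ u v i, (∀ k, star (w k) ⬝ᵥ v = 0) → P.prob (tensor₂ u v) i = R.prob (tensor₂ u v) i := by
  let next : Fin (m + 1) → Protocol ι a b := Fin.cons R Q
  refine ⟨.snd (m + 1) (fun _ => b) (projections w) (sum_projections hw) next,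
    fun k u i => ?_, fun u v i h => ?_⟩
  · exact Protocol.prob_snd_of_fixed _ next u _ i k.succ (projections_succ_mulVec hw k)
  · exact Protocol.prob_snd_of_fixed _ next u _ i 0 (projections_zero_mulVec h)

/-- The second party tests for `p`; if it is found, the first party measures in the basis `q`;
otherwise the first party measures in the basis `r`, with outcome `l` say, and the second party
completes the identification by measuring in the family `f l`. -/
theorem finiteLOCCDistinguishable_of_tree {ι : Type} [DecidableEq ι] {a b m n N : ℕ}
    {ψ : ι → Fin a × Fin b → ℂ} {p : Fin b → ℂ} {q : Fin m → Fin a → ℂ} {r : Fin n → Fin a → ℂ}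
    {f : Fin n → Fin N → Fin b → ℂ} (i₀ : ι) (g : Fin m → ι) (h : Fin n → Fin N → ι)
    (hp : star p ⬝ᵥ p = 1) (hq : IsOrthonormal q) (hr : IsOrthonormal r)
    (hf : ∀ l, IsOrthonormal (f l)) (hpf : ∀ l k, star p ⬝ᵥ f l k = 0)
    (hψ : ∀ i, (∃ k, g k = i ∧ ψ i = tensor₂ (q k) p) ∨
      ∃ l k, h l k = i ∧ ψ i = tensor₂ (r l) (f l k)) :
    FiniteLOCCDistinguishable ψ := by
  -- The guess `i₀` fills the complementary outcomes, which have probability zero on the states that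
  -- reach these measurements.
  obtain ⟨Q, hQ, -⟩ := exists_protocol_fst (b := b) hq (fun k => .guess (g k)) (.guess i₀)
  choose S hS _ using fun l =>
    exists_protocol_snd (a := a) (hf l) (fun k => .guess (h l k)) (.guess i₀)
  obtain ⟨R, hR, -⟩ := exists_protocol_fst hr S (.guess i₀)
  obtain ⟨P, hP, hP'⟩ := exists_protocol_snd (w := fun _ : Fin 1 => p)
    (fun k l => by rw [hp, if_pos (Subsingleton.elim k l)]) (fun _ => Q) R
  have hnorm : ∀ {c : ℕ} {v : Fin c → ℂ}, star v ⬝ᵥ v = 1 → sqNorm v = 1 := fun hv => by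
    rw [sqNorm_eq_re, hv, Complex.one_re]
  refine ⟨P, fun i => ?_⟩
  rcases hψ i with ⟨k, rfl, hi⟩ | ⟨l, k, rfl, hi⟩
  · rw [hi, hP 0, hQ, Protocol.prob_guess, if_pos rfl, sqNorm_tensor₂, hnorm hp,
      hnorm (by rw [hq, if_pos rfl]), mul_one]
  · rw [hi, hP' _ _ _ fun _ => hpf l k, hR, hS, Protocol.prob_guess, if_pos rfl, sqNorm_tensor₂,
      hnorm (by rw [hr, if_pos rfl]), hnorm (by rw [hf, if_pos rfl]), mul_one]

/-! ### The ten states -/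

section

variable {d : ℕ} (i j k l : Fin d)

theorem ket_dotProduct_ket : star (ket i) ⬝ᵥ ket j = if i = j then 1 else 0 := by
  rw [ket, ket, ← Pi.single_star, star_one, single_dotProduct, one_mul, Pi.single_apply]

theorem ket_dotProduct_ketSub : star (ket i) ⬝ᵥ ketSub j k =
    ((Real.sqrt 2 : ℝ) : ℂ)⁻¹ * ((if i = j then 1 else 0) - if i = k then 1 else 0) := by
  rw [ketSub, dotProduct_smul, dotProduct_sub, ket_dotProduct_ket, ket_dotProduct_ket, smul_eq_mul]

theorem ket_dotProduct_ketAdd : star (ket i) ⬝ᵥ ketAdd j k =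
    ((Real.sqrt 2 : ℝ) : ℂ)⁻¹ * ((if i = j then 1 else 0) + if i = k then 1 else 0) := by
  rw [ketAdd, dotProduct_smul, dotProduct_add, ket_dotProduct_ket, ket_dotProduct_ket, smul_eq_mul]

theorem star_inv_sqrt_two :
    star ((Real.sqrt 2 : ℝ) : ℂ)⁻¹ = ((Real.sqrt 2 : ℝ) : ℂ)⁻¹ := by
  simp

theorem ketSub_dotProduct_ket : star (ketSub j k) ⬝ᵥ ket i =
    ((Real.sqrt 2 : ℝ) : ℂ)⁻¹ * ((if j = i then 1 else 0) - if k = i then 1 else 0) := by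
  rw [ketSub, star_smul, star_sub, smul_dotProduct, sub_dotProduct, ket_dotProduct_ket,
    ket_dotProduct_ket, smul_eq_mul, star_inv_sqrt_two]

theorem ketAdd_dotProduct_ket : star (ketAdd j k) ⬝ᵥ ket i =
    ((Real.sqrt 2 : ℝ) : ℂ)⁻¹ * ((if j = i then 1 else 0) + if k = i then 1 else 0) := by
  rw [ketAdd, star_smul, star_add, smul_dotProduct, add_dotProduct, ket_dotProduct_ket,
    ket_dotProduct_ket, smul_eq_mul, star_inv_sqrt_two]

theorem ketSub_dotProduct_ketSub : star (ketSub i j) ⬝ᵥ ketSub k l =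
    1 / 2 * (((if i = k then 1 else 0) - if i = l then 1 else 0) -
      ((if j = k then 1 else 0) - if j = l then 1 else 0)) := by
  simp only [ketSub, star_smul_dotProduct_smul, star_sub, sub_dotProduct, dotProduct_sub,
    ket_dotProduct_ket]
  ring

theorem ketSub_dotProduct_ketAdd : star (ketSub i j) ⬝ᵥ ketAdd k l =
    1 / 2 * (((if i = k then 1 else 0) + if i = l then 1 else 0) -
      ((if j = k then 1 else 0) + if j = l then 1 else 0)) := by
  simp only [ketSub, ketAdd, star_smul_dotProduct_smul, star_sub, sub_dotProduct, dotProduct_add,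
    ket_dotProduct_ket]
  ring

theorem ketAdd_dotProduct_ketSub : star (ketAdd i j) ⬝ᵥ ketSub k l =
    1 / 2 * (((if i = k then 1 else 0) - if i = l then 1 else 0) +
      ((if j = k then 1 else 0) - if j = l then 1 else 0)) := by
  simp only [ketSub, ketAdd, star_smul_dotProduct_smul, star_add, add_dotProduct, dotProduct_sub,
    ket_dotProduct_ket]
  ring

theorem ketAdd_dotProduct_ketAdd : star (ketAdd i j) ⬝ᵥ ketAdd k l =
    1 / 2 * (((if i = k then 1 else 0) + if i = l then 1 else 0) +
      ((if j = k then 1 else 0) + if j = l then 1 else 0)) := by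
  simp only [ketAdd, star_smul_dotProduct_smul, star_add, add_dotProduct, dotProduct_add,
    ket_dotProduct_ket]
  ring

end

theorem tensor₃_dotProduct_tensor₃ {a b c : ℕ} (u u' : Fin a → ℂ) (v v' : Fin b → ℂ)
    (w w' : Fin c → ℂ) : star (tensor₃ u v w) ⬝ᵥ tensor₃ u' v' w' =
      (star u ⬝ᵥ u') * (star v ⬝ᵥ v') * (star w ⬝ᵥ w') := by
  simp only [dotProduct, tensor₃, Fintype.sum_prod_type, Pi.star_apply, star_mul']
  rw [Finset.sum_mul_sum, Finset.sum_mul]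
  refine Finset.sum_congr rfl fun x _ => ?_
  rw [Finset.sum_mul]
  refine Finset.sum_congr rfl fun y _ => ?_
  rw [Finset.mul_sum]
  exact Finset.sum_congr rfl fun z _ => by ring

/-- `|u⟩|v⟩` as a vector of the single system `ℂ^(m * n)`. -/
def merge {m n : ℕ} (u : Fin m → ℂ) (v : Fin n → ℂ) : Fin (m * n) → ℂ :=
  fun x => tensor₂ u v (finProdFinEquiv.symm x)

theorem merge_dotProduct_merge {m n : ℕ} (u u' : Fin m → ℂ) (v v' : Fin n → ℂ) :
    star (merge u v) ⬝ᵥ merge u' v' = (star u ⬝ᵥ u') * (star v ⬝ᵥ v') := by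
  rw [← dotProduct_tensor₂]
  exact Equiv.sum_comp finProdFinEquiv.symm fun x => star (tensor₂ u v) x * tensor₂ u' v' x

theorem merge_halfSub_left {m n : ℕ} (u u' : Fin m → ℂ) (v : Fin n → ℂ) :
    merge (halfSub u u') v = halfSub (merge u v) (merge u' v) := by
  ext x
  simp [merge, tensor₂, halfSub]
  ring

theorem merge_halfAdd_left {m n : ℕ} (u u' : Fin m → ℂ) (v : Fin n → ℂ) :
    merge (halfAdd u u') v = halfAdd (merge u v) (merge u' v) := by
  ext x
  simp [merge, tensor₂, halfAdd]
  ring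

theorem merge_halfSub_right {m n : ℕ} (u : Fin m → ℂ) (v v' : Fin n → ℂ) :
    merge u (halfSub v v') = halfSub (merge u v) (merge u v') := by
  ext x
  simp [merge, tensor₂, halfSub]
  ring

theorem merge_halfAdd_right {m n : ℕ} (u : Fin m → ℂ) (v v' : Fin n → ℂ) :
    merge u (halfAdd v v') = halfAdd (merge u v) (merge u v') := by
  ext x
  simp [merge, tensor₂, halfAdd]
  ring

theorem acrossA_BC_tensor₃ (u : Fin 3 → ℂ) (v w : Fin 2 → ℂ) :
    acrossA_BC (tensor₃ u v w) = tensor₂ u (merge v w) := by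
  ext x
  simp [acrossA_BC, tensor₃, tensor₂, merge, mul_assoc]

theorem acrossB_CA_tensor₃ (u : Fin 3 → ℂ) (v w : Fin 2 → ℂ) :
    acrossB_CA (tensor₃ u v w) = tensor₂ v (merge w u) := by
  ext x
  simp only [acrossB_CA, tensor₃, tensor₂, merge]
  ring

theorem acrossC_AB_tensor₃ (u : Fin 3 → ℂ) (v w : Fin 2 → ℂ) :
    acrossC_AB (tensor₃ u v w) = tensor₂ w (merge u v) := by
  ext x
  simp only [acrossC_AB, tensor₃, tensor₂, merge]
  ring

theorem isOrthonormal_state : IsOrthonormal state := by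
  intro i j
  fin_cases i <;> fin_cases j <;>
    simp [state, tensor₃_dotProduct_tensor₃, ket_dotProduct_ket, ket_dotProduct_ketSub,
      ket_dotProduct_ketAdd, ketSub_dotProduct_ket, ketAdd_dotProduct_ket,
      ketSub_dotProduct_ketSub, ketSub_dotProduct_ketAdd, ketAdd_dotProduct_ketSub,
      ketAdd_dotProduct_ketAdd] <;> norm_num

theorem isOrthonormal_ket {d : ℕ} : IsOrthonormal (ket : Fin d → Fin d → ℂ) :=
  ket_dotProduct_ket

theorem isOrthonormal_ketSub_ketAdd :
    IsOrthonormal ![(ketSub 0 1 : Fin 2 → ℂ), ketAdd 0 1] := by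
  intro i j
  fin_cases i <;> fin_cases j <;>
    simp [ketSub_dotProduct_ketSub, ketSub_dotProduct_ketAdd, ketAdd_dotProduct_ketSub,
      ketAdd_dotProduct_ketAdd] <;> norm_num

/-! ### The protocols across `B|CA` and `C|AB` -/

theorem finiteLOCCDistinguishable_acrossB_CA :
    FiniteLOCCDistinguishable fun i => acrossB_CA (state i) := by
  -- `p` is `|1⟩` in `C` and `|0⟩` in `A`, the joint factor of `ψ₉, ψ₁₀`. The rows of `f` are the
  -- joint factors of `ψ₁, ψ₂, ψ₇, ψ₈` (`B` in `|0⟩`) and of `ψ₃, …, ψ₆` (`B` in `|1⟩`).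
  refine finiteLOCCDistinguishable_of_tree (p := merge (ket 1) (ket 0))
    (q := ![ketSub 0 1, ketAdd 0 1]) (r := ket)
    (f := fun l k => merge
      (![![ket 0, ket 0, ket 1, ket 1],
        ![ket 0, ket 0, ketSub 0 1, ketAdd 0 1]] l k)
      (![![ketSub 0 1, ketAdd 0 1, ketSub 1 2, ketAdd 1 2],
        ![ketSub 2 0, ketAdd 2 0, ket 1, ket 1]] l k))
    0 ![8, 9] ![![0, 1, 6, 7], ![2, 3, 4, 5]] ?_ isOrthonormal_ketSub_ketAdd isOrthonormal_ket
    ?_ ?_ ?_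
  · simp only [merge_dotProduct_merge, ket_dotProduct_ket, if_true, mul_one]
  · intro l i j
    rw [merge_dotProduct_merge]
    fin_cases l <;> fin_cases i <;> fin_cases j <;>
      simp [ket_dotProduct_ket, ket_dotProduct_ketSub,
        ket_dotProduct_ketAdd, ketSub_dotProduct_ket, ketAdd_dotProduct_ket,
        ketSub_dotProduct_ketSub, ketSub_dotProduct_ketAdd, ketAdd_dotProduct_ketSub,
        ketAdd_dotProduct_ketAdd] <;> norm_num
  · intro l k
    rw [merge_dotProduct_merge]
    fin_cases l <;> fin_cases k <;>
      simp [ket_dotProduct_ket, ket_dotProduct_ketSub,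
        ket_dotProduct_ketAdd]
  · intro i
    fin_cases i
    · exact Or.inr ⟨0, 0, rfl, acrossB_CA_tensor₃ _ _ _⟩
    · exact Or.inr ⟨0, 1, rfl, acrossB_CA_tensor₃ _ _ _⟩
    · exact Or.inr ⟨1, 0, rfl, acrossB_CA_tensor₃ _ _ _⟩
    · exact Or.inr ⟨1, 1, rfl, acrossB_CA_tensor₃ _ _ _⟩
    · exact Or.inr ⟨1, 2, rfl, acrossB_CA_tensor₃ _ _ _⟩
    · exact Or.inr ⟨1, 3, rfl, acrossB_CA_tensor₃ _ _ _⟩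
    · exact Or.inr ⟨0, 2, rfl, acrossB_CA_tensor₃ _ _ _⟩
    · exact Or.inr ⟨0, 3, rfl, acrossB_CA_tensor₃ _ _ _⟩
    · exact Or.inl ⟨0, rfl, acrossB_CA_tensor₃ _ _ _⟩
    · exact Or.inl ⟨1, rfl, acrossB_CA_tensor₃ _ _ _⟩

theorem finiteLOCCDistinguishable_acrossC_AB :
    FiniteLOCCDistinguishable fun i => acrossC_AB (state i) := by
  -- `p` is `|1⟩` in `A` and in `B`, the joint factor of `ψ₅, ψ₆`. The rows of `f` belong to `ψ₁, …,
  -- ψ₄` (`C` in `|0⟩`) and `ψ₇, …, ψ₁₀` (`C` in `|1⟩`).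
  refine finiteLOCCDistinguishable_of_tree (p := merge (ket 1) (ket 1))
    (q := ![ketSub 0 1, ketAdd 0 1]) (r := ket)
    (f := fun l k => merge
      (![![ketSub 0 1, ketAdd 0 1, ketSub 2 0, ketAdd 2 0],
        ![ketSub 1 2, ketAdd 1 2, ket 0, ket 0]] l k)
      (![![ket 0, ket 0, ket 1, ket 1],
        ![ket 0, ket 0, ketSub 0 1, ketAdd 0 1]] l k))
    0 ![4, 5] ![![0, 1, 2, 3], ![6, 7, 8, 9]] ?_ isOrthonormal_ketSub_ketAdd isOrthonormal_ket
    ?_ ?_ ?_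
  · simp only [merge_dotProduct_merge, ket_dotProduct_ket, if_true, mul_one]
  · intro l i j
    rw [merge_dotProduct_merge]
    fin_cases l <;> fin_cases i <;> fin_cases j <;>
      simp [ket_dotProduct_ket, ket_dotProduct_ketSub,
        ket_dotProduct_ketAdd, ketSub_dotProduct_ket, ketAdd_dotProduct_ket,
        ketSub_dotProduct_ketSub, ketSub_dotProduct_ketAdd, ketAdd_dotProduct_ketSub,
        ketAdd_dotProduct_ketAdd] <;> norm_num
  · intro l k
    rw [merge_dotProduct_merge]
    fin_cases l <;> fin_cases k <;>
      simp [ket_dotProduct_ket, ket_dotProduct_ketSub,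
        ket_dotProduct_ketAdd]
  · intro i
    fin_cases i
    · exact Or.inr ⟨0, 0, rfl, acrossC_AB_tensor₃ _ _ _⟩
    · exact Or.inr ⟨0, 1, rfl, acrossC_AB_tensor₃ _ _ _⟩
    · exact Or.inr ⟨0, 2, rfl, acrossC_AB_tensor₃ _ _ _⟩
    · exact Or.inr ⟨0, 3, rfl, acrossC_AB_tensor₃ _ _ _⟩
    · exact Or.inl ⟨0, rfl, acrossC_AB_tensor₃ _ _ _⟩
    · exact Or.inl ⟨1, rfl, acrossC_AB_tensor₃ _ _ _⟩
    · exact Or.inr ⟨1, 0, rfl, acrossC_AB_tensor₃ _ _ _⟩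
    · exact Or.inr ⟨1, 1, rfl, acrossC_AB_tensor₃ _ _ _⟩
    · exact Or.inr ⟨1, 2, rfl, acrossC_AB_tensor₃ _ _ _⟩
    · exact Or.inr ⟨1, 3, rfl, acrossC_AB_tensor₃ _ _ _⟩

/-! ### The bipartition `A|BC` and the domino states -/

theorem acrossA_BC_state_eq_tileState (j : Fin 8) :
    acrossA_BC (state (Fin.natAdd 2 j)) =
      tileState ket ![merge (ket 1) (ket 0), merge (ket 1) (ket 1), merge (ket 0) (ket 1)] j := by
  fin_cases j
  -- `ketSub i j` and `ketAdd i j` unfold to `halfSub` and `halfAdd` of kets; only superpositions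
  -- within `BC` must be moved through `merge`.
  · exact acrossA_BC_tensor₃ _ _ _
  · exact acrossA_BC_tensor₃ _ _ _
  · exact (acrossA_BC_tensor₃ _ _ _).trans (congrArg _ (merge_halfSub_right _ _ _))
  · exact (acrossA_BC_tensor₃ _ _ _).trans (congrArg _ (merge_halfAdd_right _ _ _))
  · exact acrossA_BC_tensor₃ _ _ _
  · exact acrossA_BC_tensor₃ _ _ _
  · exact (acrossA_BC_tensor₃ _ _ _).trans (congrArg _ (merge_halfSub_left _ _ _))
  · exact (acrossA_BC_tensor₃ _ _ _).trans (congrArg _ (merge_halfAdd_left _ _ _))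

theorem sqNorm_acrossA_BC (v : Fin 3 × Fin 2 × Fin 2 → ℂ) : sqNorm (acrossA_BC v) = sqNorm v :=
  Equiv.sum_comp ((Equiv.refl _).prodCongr finProdFinEquiv.symm) fun x => ‖v x‖ ^ 2

theorem sqNorm_state (i : Fin 10) : sqNorm (state i) = 1 := by
  rw [sqNorm_eq_re, isOrthonormal_state, if_pos rfl, Complex.one_re]

/-- The labelling `c` lets one argument serve both the eight states and all ten. -/
theorem not_loccDistinguishable_acrossA_BC {ι : Type} [DecidableEq ι] (c : ι → Fin 10)
    {e : Fin 8 → ι} (he : ∀ j, c (e j) = Fin.natAdd 2 j) :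
    ¬ LOCCDistinguishable fun i => acrossA_BC (state (c i)) := by
  have hinj : Function.Injective e := fun i j h => by
    have := congrArg c h
    rw [he, he] at this
    exact Fin.natAdd_injective _ _ this
  refine not_loccDistinguishable_of_tileState hinj
    (fun j => by rw [he, acrossA_BC_state_eq_tileState]) (fun s => ?_) (fun s => ?_) fun j => ?_
  · rw [sqNorm_eq_re, ket_dotProduct_ket, if_pos rfl, Complex.one_re]
  · have h : ∀ i j : Fin 2, sqNorm (merge (ket i) (ket j)) = 1 := fun i j => by
      rw [sqNorm_eq_re, merge_dotProduct_merge, ket_dotProduct_ket, ket_dotProduct_ket, if_pos rfl,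
        if_pos rfl, mul_one, Complex.one_re]
    fin_cases s
    exacts [h 1 0, h 1 1, h 0 1]
  · rw [← acrossA_BC_state_eq_tileState, sqNorm_acrossA_BC, sqNorm_state]

/-- The index of the state that becomes the `j`-th domino state. -/
def dominoIndex : Fin 8 ≃ {i : Fin 10 // 2 ≤ i} where
  toFun := ![⟨5, by decide⟩, ⟨4, by decide⟩, ⟨7, by decide⟩, ⟨6, by decide⟩,
    ⟨9, by decide⟩, ⟨8, by decide⟩, ⟨3, by decide⟩, ⟨2, by decide⟩]
  -- The first two entries are fillers, never reached since `2 ≤ i`.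
  invFun i := ![0, 0, 7, 6, 1, 0, 3, 2, 5, 4] i
  left_inv := by decide
  right_inv := by decide

/-- The permutation of the basis of `A` that turns `ψ₃, …, ψ₁₀` into the domino states. -/
def dominoPerm : Equiv.Perm (Fin 3) where
  toFun := ![2, 0, 1]
  invFun := ![1, 2, 0]
  left_inv := by decide
  right_inv := by decide

/-- The one sign comes from `ψ₉`: the relabelling sends `|01⟩ - |11⟩` to `|2⟩ - |1⟩`, the negative
of the order used in `domino`. -/
theorem state_dominoIndex (j : Fin 8) (a : Fin 3) (b c : Fin 2) :
    state (dominoIndex j) (a, b, c) = (if j = 5 then -1 else 1) *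
      embed (domino j) (dominoPerm a, relabelBC (b, c)) := by
  fin_cases j <;> fin_cases a <;> fin_cases b <;> fin_cases c <;>
    simp [state, dominoIndex, dominoPerm, domino, embed, relabelBC, tensor₃, tensor₂, ketAdd, ketSub, ket]

end ProductStates

theorem mainTheorem4 :
    -- the ten product states are orthonormal
    (∀ i j, ∑ x, star (ProductStates.state i x) * ProductStates.state j x =
      if i = j then 1 else 0) ∧
    -- they are perfectly distinguishable across `B|CA` and across `C|AB`, in finitely many rounds
    ProductStates.FiniteLOCCDistinguishable
      (fun i => ProductStates.acrossB_CA (ProductStates.state i)) ∧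
    ProductStates.FiniteLOCCDistinguishable
      (fun i => ProductStates.acrossC_AB (ProductStates.state i)) ∧
    -- up to phases and relabelling of the local bases, `ψ₃, …, ψ₁₀` are the eight domino states
    (∃ (σ : Equiv.Perm (Fin 3)) (f : Fin 8 ≃ {i : Fin 10 // 2 ≤ i}), ∀ j, ∃ z : ℂ, ‖z‖ = 1 ∧
      ∀ a b c, ProductStates.state (f j) (a, b, c) =
        z * ProductStates.embed (ProductStates.domino j) (σ a, ProductStates.relabelBC (b, c))) ∧
    -- these eight states, hence all ten, are not perfectly distinguishable across `A|BC`,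
    -- not even with infinitely many rounds
    ¬ ProductStates.LOCCDistinguishable
      (fun i : {i : Fin 10 // 2 ≤ i} => ProductStates.acrossA_BC (ProductStates.state i)) ∧
    ¬ ProductStates.LOCCDistinguishable
      (fun i => ProductStates.acrossA_BC (ProductStates.state i)) := by
  refine ⟨ProductStates.isOrthonormal_state,
    ProductStates.finiteLOCCDistinguishable_acrossB_CA,
    ProductStates.finiteLOCCDistinguishable_acrossC_AB,
    ⟨ProductStates.dominoPerm, ProductStates.dominoIndex, fun j =>
      ⟨if j = 5 then -1 else 1, by split_ifs <;> simp, ProductStates.state_dominoIndex j⟩⟩,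
    ProductStates.not_loccDistinguishable_acrossA_BC (e := fun j => ⟨Fin.natAdd 2 j, ?_⟩)
      Subtype.val fun j => rfl,
    ProductStates.not_loccDistinguishable_acrossA_BC (e := Fin.natAdd 2) id fun j => rfl⟩
  exact Fin.le_def.mpr (Nat.le_add_right 2 j)
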